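/- Let $M\ge 2$ be an integer, let $d,\lambda,\rho>0$, and let $x\in[-1,1]$. For $v\in\mathbb R$ let $\mathbf a(v)=\big[1,\ e^{j\frac{2\pi d}{\lambda}v},\dots,e^{j\frac{2\pi d}{\lambda}(M-1)v}\big]^{\mathrm H}\in\mathbb C^M$ (a column vector), and let $[u]_{-1}^{1}=\max\{\min\{u,1\},-1\}$. Let $z_1,z_2,\dots$ be i.i.d. circularly symmetric complex Gaussian random variables with mean $0$ and variance $1$, and let $\hat x_0$ be a real random variable that is independent of $(z_n)_{n\ge1}$. Let $\alpha>0$, $N_0\ge 0$ be real numbers and $a_n=\alpha/(n+N_0)$. For $n\ge1$ define recursively $$\mathbf w_n=\frac{\mathbf a(\hat x_{n-1})}{\sqrt M},\qquad y_n=\mathbf w_n^{\mathrm H}\mathbf a(x)+\frac{z_n}{\sqrt\rho},\qquad \hat x_n=\big[\hat x_{n-1}-a_n\operatorname{Im}\{y_n\}\big]_{-1}^{1}.$$ Let $$f(v,x)=-\frac1{\sqrt M}\operatorname{Im}\{\mathbf a(v)^{\mathrm H}\mathbf a(x)\}=-\frac1{\sqrt M}\sum_{m=1}^{M}\sin\Big(\frac{2\pi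 d(m-1)(v-x)}{\lambda}\Big)$$ and $\mathcal S(x)=\{v\in(-1,1]: f(v,x)=0,\ \partial_v f(v,x)<0\}$. Then $$\mathcal S(x)=\Big\{v\in(-1,1]: v=x+\frac{k\lambda}{(M-1)d}\text{ for some }k\in\mathbb Z\Big\},$$ and, with probability one, $\hat x_n$ converges as $n\to\infty$ to a single (possibly random) point of $\mathcal S(x)\cup\{-1\}\cup\{1\}$. -/

import Mathlib

open MeasureTheory ProbabilityTheory Filter Topology Matrix
open scoped NNReal

namespace BeamTracking

noncomputable section

/-- The circularly symmetric complex Gaussian distribution `CN(u, s)` with mean `u` and variance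
`s`: the real and imaginary parts are independent, each of variance `s / 2`. -/
def complexGaussian (u : ℂ) (s : ℝ≥0) : Measure ℂ :=
  ((gaussianReal 0 (s / 2)).prod (gaussianReal 0 (s / 2))).map
    fun p : ℝ × ℝ => u + ((p.1 : ℂ) + (p.2 : ℂ) * Complex.I)

/-- The steering vector `a(v)` of a linear array of `M` antennas with spacing `d` at wavelength
`lam`: the Hermitian transpose of the row `(1, e^{j 2πdv/lam}, …, e^{j 2πd(M-1)v/lam})`.
The index `m : Fin M` runs from `0` to `M - 1`. -/
def steeringVector (M : ℕ) (d lam v : ℝ) : Fin M → ℂ :=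
  star fun m : Fin M => Complex.exp (Complex.I * ((2 * Real.pi * d / lam * (m : ℕ) * v : ℝ) : ℂ))

/-- The analog beamforming vector `a(v) / √M` pointing in the direction `v`. -/
def beamformer (M : ℕ) (d lam v : ℝ) : Fin M → ℂ :=
  ((1 / √(M : ℝ) : ℝ) : ℂ) • steeringVector M d lam v

/-- The observation `w^H a(x) + z / √ρ` obtained with the beamforming vector `w`, when the beam
direction is `x`, the SNR is `ρ` and the noise is `z`. -/
def observation (M : ℕ) (d lam ρ x : ℝ) (w : Fin M → ℂ) (z : ℂ) : ℂ :=
  star w ⬝ᵥ steeringVector M d lam x + z / ((√ρ : ℝ) : ℂ)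

/-- The projection `[v]_{-1}^{1}` onto the feasible region `[-1, 1]`. -/
def proj (v : ℝ) : ℝ := max (min v 1) (-1)

/-- The diminishing step size `a_n = α / (n + N₀)`. -/
def stepSize (α N₀ : ℝ) (n : ℕ) : ℝ := α / ((n : ℝ) + N₀)

/-- The sequence of estimates of the recursive beam tracker with step sizes `a`, for the static
beam direction `x`, started at `x₀` and driven by the noise values `z 1, z 2, …`
(the value `z 0` is not used): in time slot `n ≥ 1` the beamformer points in the direction of the
estimate number `n - 1`, and `x̂_n = [x̂_{n-1} - a_n Im y_n]_{-1}^{1}`. -/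
def estimate (M : ℕ) (d lam ρ x : ℝ) (a : ℕ → ℝ) (x₀ : ℝ) (z : ℕ → ℂ) : ℕ → ℝ
  | 0 => x₀
  | n + 1 =>
    proj (estimate M d lam ρ x a x₀ z n - a (n + 1) *
      (observation M d lam ρ x
        (beamformer M d lam (estimate M d lam ρ x a x₀ z n)) (z (n + 1))).im)

/-- The mean field `f(v, x) = -(1/√M) Im (a(v)^H a(x))`. -/
def meanField (M : ℕ) (d lam v x : ℝ) : ℝ :=
  -(1 / √(M : ℝ)) * (star (steeringVector M d lam v) ⬝ᵥ steeringVector M d lam x).im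

/-- The mean field as an explicit sum of sines. -/
theorem meanField_eq_sum (M : ℕ) (d lam v x : ℝ) :
    meanField M d lam v x =
      -(1 / √(M : ℝ)) * ∑ m : Fin M, Real.sin (2 * Real.pi * d * (m : ℕ) * (v - x) / lam) := by
  unfold meanField steeringVector
  congr 1
  simp only [star_star, dotProduct, Complex.im_sum]
  refine Finset.sum_congr rfl fun m _ => ?_
  rw [Pi.star_apply, Complex.star_def, ← Complex.exp_conj, ← Complex.exp_add]
  have h : Complex.I * ((2 * Real.pi * d / lam * (m : ℕ) * v : ℝ) : ℂ) +
      (starRingEnd ℂ) (Complex.I * ((2 * Real.pi * d / lam * (m : ℕ) * x : ℝ) : ℂ)) =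
      ((2 * Real.pi * d * (m : ℕ) * (v - x) / lam : ℝ) : ℂ) * Complex.I := by
    rw [map_mul, Complex.conj_I, Complex.conj_ofReal]
    push_cast
    ring
  rw [h, Complex.exp_ofReal_mul_I_im]

/-- The set `S(x)` of stable points: the points of `(-1, 1]` at which the mean field
vanishes and has a negative derivative in its first argument. -/
def stablePoints (M : ℕ) (d lam x : ℝ) : Set ℝ :=
  {v | v ∈ Set.Ioc (-1 : ℝ) 1 ∧ meanField M d lam v x = 0 ∧
    deriv (fun u => meanField M d lam u x) v < 0}

end

end BeamTracking

/-! With `t = πd(v - x)/λ`, the mean field is a negative multiple of `G(t) = ∑ sin(2mt)`, and `G(t)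
sin t = sin((M-1)t) sin(Mt)`. Differentiating this identity shows that every zero of `G` is
nondegenerate: `G' > 0` where `sin((M-1)t) = 0`, and `G' = -M` at all other zeros. This gives the
formula for the stable set; there are only countably many zeros.

The tracker is a projected stochastic approximation whose weighted noise series converges almost
surely (an L²-bounded martingale). On such a path, `f c > 0` prevents infinitely many crossings of
`c`, since late noise cannot carry the path back against the drift; so the path converges
(`exists_tendsto`). As the step sizes are not summable, an interior limit is a zero of `f`.

An unstable zero `u` is excluded by sensitivity to a single noise value: `f` is increasing near `u`,
so two paths that differ only in the noise at time `N` never approach each other there. Given the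
initial value and the other noises, at most one value of that noise leads to `u`, and the Gaussian
law has no atoms (`ae_not_tendsto`). -/

namespace BeamTracking

/-! ### Trigonometry of the sine sum -/

theorem sum_sin_mul_sin (M : ℕ) (t : ℝ) :
    (∑ m ∈ Finset.range M, Real.sin (2 * m * t)) * Real.sin t =
      Real.sin ((M - 1) * t) * Real.sin (M * t) := by
  induction M with
  | zero => simp
  | succ n ih =>
    rw [Finset.sum_range_succ, add_mul, ih]
    have h1 : ((n : ℝ) - 1) * t = n * t - t := by ring
    have h2 : 2 * (n : ℝ) * t = 2 * (n * t) := by ring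
    have h3 : (((n + 1 : ℕ) : ℝ) - 1) * t = n * t := by push_cast; ring
    have h4 : ((n + 1 : ℕ) : ℝ) * t = n * t + t := by push_cast; ring
    rw [h1, h2, h3, h4, Real.sin_sub, Real.sin_add, Real.sin_two_mul]
    ring

theorem hasDerivAt_sum_sin (M : ℕ) (t : ℝ) :
    HasDerivAt (fun s => ∑ m ∈ Finset.range M, Real.sin (2 * m * s))
      (∑ m ∈ Finset.range M, 2 * m * Real.cos (2 * m * t)) t := by
  refine HasDerivAt.fun_sum fun m _ => ?_
  have := ((hasDerivAt_id t).const_mul (2 * (m : ℝ))).sin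
  simpa [mul_comm] using this

theorem hasDerivAt_sin_mul (c t : ℝ) :
    HasDerivAt (fun s => Real.sin (c * s)) (c * Real.cos (c * t)) t := by
  have := ((hasDerivAt_id t).const_mul c).sin
  simpa [mul_comm] using this

/-- The differentiated product formula for the sine sum. -/
theorem deriv_sum_sin_mul_sin (M : ℕ) (t : ℝ) :
    (∑ m ∈ Finset.range M, 2 * m * Real.cos (2 * m * t)) * Real.sin t +
      (∑ m ∈ Finset.range M, Real.sin (2 * m * t)) * Real.cos t =
    ((M - 1) * Real.cos ((M - 1) * t)) * Real.sin (M * t) +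
      Real.sin ((M - 1) * t) * (M * Real.cos (M * t)) := by
  have h1 := (hasDerivAt_sum_sin M t).mul (Real.hasDerivAt_sin t)
  have h2 := (hasDerivAt_sin_mul ((M : ℝ) - 1) t).mul (hasDerivAt_sin_mul (M : ℝ) t)
  refine h1.unique (h2.congr_of_eventuallyEq (Eventually.of_forall fun s => ?_))
  exact sum_sin_mul_sin M s

theorem sin_sub_one_mul (c t : ℝ) :
    Real.sin ((c - 1) * t) = Real.sin (c * t) * Real.cos t - Real.cos (c * t) * Real.sin t := by
  rw [sub_mul, one_mul, Real.sin_sub]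

/-- The case in which the product formula cannot be divided by `sin t`: all the angles are multiples
of `2π`, so every cosine is 1. -/
theorem sum_cos_pos_of_sin_eq_zero {M : ℕ} (hM : 2 ≤ M) {t : ℝ} (ht : Real.sin t = 0) :
    (∑ m ∈ Finset.range M, Real.sin (2 * m * t)) = 0 ∧
    0 < ∑ m ∈ Finset.range M, 2 * m * Real.cos (2 * m * t) := by
  obtain ⟨k, rfl⟩ := Real.sin_eq_zero_iff.1 ht
  have h (m : ℕ) : 2 * (m : ℝ) * (k * Real.pi) = ((m * k : ℤ) : ℝ) * (2 * Real.pi) := by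
    push_cast; ring
  have hs (m : ℕ) : Real.sin (2 * (m : ℝ) * (k * Real.pi)) = 0 :=
    Real.sin_eq_zero_iff.2 ⟨2 * m * k, by push_cast; ring⟩
  have hc (m : ℕ) : Real.cos (2 * (m : ℝ) * (k * Real.pi)) = 1 := by
    rw [h, Real.cos_int_mul_two_pi]
  simp only [hs, hc, Finset.sum_const_zero, true_and, mul_one]
  refine Finset.sum_pos' (fun m _ => by positivity) ⟨1, Finset.mem_range.2 (by omega), by norm_num⟩

theorem sum_sin_stable {M : ℕ} (hM : 2 ≤ M) {t : ℝ} (ht : Real.sin ((M - 1) * t) = 0) :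
    (∑ m ∈ Finset.range M, Real.sin (2 * m * t)) = 0 ∧
    0 < ∑ m ∈ Finset.range M, 2 * m * Real.cos (2 * m * t) := by
  by_cases h0 : Real.sin t = 0
  · exact sum_cos_pos_of_sin_eq_zero hM h0
  have h1 := sum_sin_mul_sin M t
  have h2 := deriv_sum_sin_mul_sin M t
  rw [ht, zero_mul] at h1
  have hG := (mul_eq_zero.1 h1).resolve_right h0
  refine ⟨hG, ?_⟩
  rw [hG, ht, zero_mul, zero_mul, add_zero, add_zero] at h2
  have h3 : Real.sin (M * t) = Real.cos ((M - 1) * t) * Real.sin t := by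
    have : (M : ℝ) * t = (M - 1) * t + t := by ring
    rw [this, Real.sin_add, ht]; ring
  have h4 : Real.cos ((M - 1) * t) ^ 2 = 1 := by
    have := Real.sin_sq_add_cos_sq ((M - 1) * t)
    rw [ht] at this; linarith
  rw [h3] at h2
  -- The differentiated product formula divided by `sin t`, using `cos² = 1`.
  have h5 : (∑ m ∈ Finset.range M, 2 * m * Real.cos (2 * m * t)) = (M : ℝ) - 1 := by
    apply mul_right_cancel₀ h0
    rw [h2]
    linear_combination ((M : ℝ) - 1) * Real.sin t * h4
  rw [h5]
  have : (2 : ℝ) ≤ M := by exact_mod_cast hM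
  linarith

theorem sum_sin_unstable {M : ℕ} (hM : 2 ≤ M) {t : ℝ} (ht : Real.sin ((M - 1) * t) ≠ 0)
    (hG : (∑ m ∈ Finset.range M, Real.sin (2 * m * t)) = 0) :
    Real.sin (M * t) = 0 ∧ (∑ m ∈ Finset.range M, 2 * m * Real.cos (2 * m * t)) < 0 := by
  have h1 := sum_sin_mul_sin M t
  have h2 := deriv_sum_sin_mul_sin M t
  rw [hG, zero_mul] at h1
  have hs := (mul_eq_zero.1 h1.symm).resolve_left ht
  have h3 := sin_sub_one_mul (M : ℝ) t
  refine ⟨hs, ?_⟩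
  rw [hs, zero_mul, zero_sub] at h3
  have h0 : Real.sin t ≠ 0 := by
    rintro h; rw [h, mul_zero, neg_zero] at h3; exact ht h3
  have h4 : Real.cos (M * t) ^ 2 = 1 := by
    have := Real.sin_sq_add_cos_sq (M * t)
    rw [hs] at this; linarith
  rw [hG, hs, h3] at h2
  have h5 : (∑ m ∈ Finset.range M, 2 * m * Real.cos (2 * m * t)) = -(M : ℝ) := by
    apply mul_right_cancel₀ h0
    linear_combination h2 - (M : ℝ) * Real.sin t * h4
  rw [h5]
  have : (2 : ℝ) ≤ M := by exact_mod_cast hM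
  linarith

/-! ### Zeros of the mean field and their stability -/

theorem meanField_eq_range_sum (M : ℕ) (d lam v x : ℝ) :
    meanField M d lam v x = -(1 / √(M : ℝ)) *
      ∑ m ∈ Finset.range M, Real.sin (2 * m * (Real.pi * d / lam * (v - x))) := by
  rw [meanField_eq_sum, Finset.sum_range]
  congr 1
  refine Finset.sum_congr rfl fun m _ => ?_
  congr 1
  ring

theorem hasDerivAt_meanField (M : ℕ) (d lam v x : ℝ) :
    HasDerivAt (fun u => meanField M d lam u x)
      (-(1 / √(M : ℝ)) * ((∑ m ∈ Finset.range M,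
        2 * m * Real.cos (2 * m * (Real.pi * d / lam * (v - x)))) * (Real.pi * d / lam))) v := by
  simp only [meanField_eq_range_sum]
  refine HasDerivAt.const_mul _ ?_
  have h : HasDerivAt (fun u : ℝ => Real.pi * d / lam * (u - x)) (Real.pi * d / lam) v := by
    simpa using ((hasDerivAt_id v).sub_const x).const_mul (Real.pi * d / lam)
  exact (hasDerivAt_sum_sin M (Real.pi * d / lam * (v - x))).comp v h

theorem continuous_meanField (M : ℕ) (d lam x : ℝ) :
    Continuous fun u => meanField M d lam u x := by
  simp only [meanField_eq_range_sum]
  fun_prop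

theorem continuous_deriv_meanField (M : ℕ) (d lam x : ℝ) :
    Continuous (deriv fun u => meanField M d lam u x) := by
  rw [funext fun v => (hasDerivAt_meanField M d lam v x).deriv]
  fun_prop

theorem sin_mul_eq_zero_iff {c d lam : ℝ} (hc : 0 < c) (hd : 0 < d) (hlam : 0 < lam) (v x : ℝ) :
    Real.sin (c * (Real.pi * d / lam * (v - x))) = 0 ↔ ∃ k : ℤ, v = x + k * lam / (c * d) := by
  rw [Real.sin_eq_zero_iff]
  refine exists_congr fun k => ?_
  have hpi := Real.pi_pos
  constructor
  · intro h
    have : (k : ℝ) * lam = c * d * (v - x) := by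
      field_simp at h
      apply mul_left_cancel₀ hpi.ne'
      linear_combination Real.pi * h
    rw [this]
    field_simp
    ring
  · rintro rfl
    field_simp
    ring

section

variable {M : ℕ} {d lam : ℝ} (hM : 2 ≤ M) (hd : 0 < d) (hlam : 0 < lam)
include hM hd hlam

theorem meanField_zero_deriv_neg_iff (v x : ℝ) :
    (meanField M d lam v x = 0 ∧ deriv (fun u => meanField M d lam u x) v < 0) ↔
      ∃ k : ℤ, v = x + k * lam / (((M : ℝ) - 1) * d) := by
  have hM2 : (2 : ℝ) ≤ M := by exact_mod_cast hM
  have hc : 0 < Real.pi * d / lam := by have := Real.pi_pos; positivity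
  have hs : 0 < 1 / √(M : ℝ) := by positivity
  rw [← sin_mul_eq_zero_iff (by linarith) hd hlam, (hasDerivAt_meanField M d lam v x).deriv,
    meanField_eq_range_sum]
  constructor
  · rintro ⟨h1, h2⟩
    by_contra h
    have h1' := (mul_eq_zero.1 h1).resolve_left (neg_ne_zero.2 hs.ne')
    have h3 := (sum_sin_unstable hM h h1').2
    have := mul_pos hs (mul_pos (neg_pos.2 h3) hc)
    linarith
  · intro h
    obtain ⟨h1, h2⟩ := sum_sin_stable hM h
    refine ⟨by rw [h1, mul_zero], ?_⟩
    have := mul_pos hs (mul_pos h2 hc)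
    linarith

theorem stablePoints_eq (x : ℝ) :
    stablePoints M d lam x =
      {v | v ∈ Set.Ioc (-1 : ℝ) 1 ∧ ∃ k : ℤ, v = x + k * lam / (((M : ℝ) - 1) * d)} := by
  ext v
  exact and_congr_right fun _ => meanField_zero_deriv_neg_iff hM hd hlam v x

theorem deriv_meanField_pos {v x : ℝ} (h0 : meanField M d lam v x = 0)
    (h : ¬ deriv (fun u => meanField M d lam u x) v < 0) :
    0 < deriv (fun u => meanField M d lam u x) v := by
  have hM2 : (2 : ℝ) ≤ M := by exact_mod_cast hM
  have hc : 0 < Real.pi * d / lam := by have := Real.pi_pos; positivity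
  have hs : 0 < 1 / √(M : ℝ) := by positivity
  have hn : Real.sin (((M : ℝ) - 1) * (Real.pi * d / lam * (v - x))) ≠ 0 := by
    rw [Ne, sin_mul_eq_zero_iff (by linarith) hd hlam,
      ← meanField_zero_deriv_neg_iff hM hd hlam]
    exact fun h' => h h'.2
  rw [meanField_eq_range_sum] at h0
  rw [(hasDerivAt_meanField M d lam v x).deriv]
  have h3 := (sum_sin_unstable hM hn ((mul_eq_zero.1 h0).resolve_left (neg_ne_zero.2 hs.ne'))).2
  have := mul_pos hs (mul_pos (neg_pos.2 h3) hc)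
  linarith

/-- By the product formula the zeros lie on two arithmetic progressions. Countability serves twice:
for a dense set where the field is nonzero, and for merging null sets over the unstable zeros. -/
theorem countable_meanField_zeros (x : ℝ) : {v | meanField M d lam v x = 0}.Countable := by
  have hM2 : (2 : ℝ) ≤ M := by exact_mod_cast hM
  have hs : 0 < 1 / √(M : ℝ) := by positivity
  refine ((Set.countable_range fun k : ℤ => x + k * lam / (((M : ℝ) - 1) * d)).union
    (Set.countable_range fun k : ℤ => x + k * lam / ((M : ℝ) * d))).mono fun v hv => ?_
  rw [Set.mem_ofPred_eq, meanField_eq_range_sum] at hv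
  have hv' := (mul_eq_zero.1 hv).resolve_left (neg_ne_zero.2 hs.ne')
  have h := sum_sin_mul_sin M (Real.pi * d / lam * (v - x))
  rw [hv', zero_mul, eq_comm, mul_eq_zero, sin_mul_eq_zero_iff (by linarith) hd hlam,
    sin_mul_eq_zero_iff (by linarith) hd hlam] at h
  rcases h with ⟨k, hk⟩ | ⟨k, hk⟩
  · exact Or.inl ⟨k, hk.symm⟩
  · exact Or.inr ⟨k, hk.symm⟩

end

/-- A continuously differentiable function with a positive derivative at `u` is monotone on a
small interval around `u`. -/
theorem exists_monotoneOn_of_deriv_pos {f : ℝ → ℝ} (hf : Differentiable ℝ f)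
    (hf' : Continuous (deriv f)) {u : ℝ} (hu : 0 < deriv f u) :
    ∃ ε > 0, MonotoneOn f (Set.Ioo (u - ε) (u + ε)) := by
  obtain ⟨ε, hε, h⟩ := Metric.eventually_nhds_iff_ball.1 (hf'.continuousAt.eventually_const_lt hu)
  refine ⟨ε, hε, ?_⟩
  rw [← Real.ball_eq_Ioo]
  refine monotoneOn_of_deriv_nonneg (convex_ball u ε) hf.continuous.continuousOn
    hf.differentiableOn fun v hv => (h v (interior_subset hv)).le

/-! ### Pathwise analysis of the projected recursion -/

theorem proj_mem_Icc (v : ℝ) : proj v ∈ Set.Icc (-1 : ℝ) 1 :=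
  ⟨le_max_right _ _, max_le (min_le_right _ _) (by norm_num)⟩

theorem proj_eq_self {v : ℝ} (hv : v ∈ Set.Icc (-1 : ℝ) 1) : proj v = v := by
  rw [proj, min_eq_left hv.2, max_eq_left hv.1]

theorem eq_of_proj_mem_Ioo {v : ℝ} (hv : proj v ∈ Set.Ioo (-1 : ℝ) 1) : proj v = v := by
  refine proj_eq_self ⟨?_, ?_⟩ <;> by_contra! h
  · have := hv.1
    rw [proj, max_eq_right ((min_le_left _ _).trans h.le)] at this
    exact this.false
  · have := hv.2
    rw [proj, min_eq_right h.le, max_eq_left (by norm_num)] at this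
    exact this.false

theorem proj_neg (v : ℝ) : proj (-v) = -proj v := by
  unfold proj
  grind

theorem continuous_proj : Continuous proj := by
  unfold proj
  fun_prop

/-- The projected stochastic approximation recursion with mean field `f`, step sizes `a` and noise
`w`, started at `x₀`. -/
def projRec (f : ℝ → ℝ) (a : ℕ → ℝ) (x₀ : ℝ) (w : ℕ → ℝ) : ℕ → ℝ
  | 0 => x₀
  | n + 1 => proj (projRec f a x₀ w n + a n * (f (projRec f a x₀ w n) + w n))

/-- A sequence satisfies the projected stochastic approximation recursion. -/
def IsProjRec (f : ℝ → ℝ) (a w v : ℕ → ℝ) : Prop :=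
  ∀ n, v (n + 1) = proj (v n + a n * (f (v n) + w n))

theorem isProjRec_projRec (f : ℝ → ℝ) (a : ℕ → ℝ) (x₀ : ℝ) (w : ℕ → ℝ) :
    IsProjRec f a w (projRec f a x₀ w) := fun _ => rfl

namespace IsProjRec

variable {f : ℝ → ℝ} {a w v : ℕ → ℝ}

/-- The initial value is an arbitrary real, so time 0 is excluded. -/
theorem mem_Icc (h : IsProjRec f a w v) {n : ℕ} (hn : 1 ≤ n) : v n ∈ Set.Icc (-1 : ℝ) 1 := by
  obtain ⟨k, rfl⟩ := Nat.exists_eq_add_of_le' hn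
  rw [h k]
  exact proj_mem_Icc _

theorem eq_of_mem_Ioo (h : IsProjRec f a w v) {n : ℕ} (hn : v (n + 1) ∈ Set.Ioo (-1 : ℝ) 1) :
    v (n + 1) = v n + a n * (f (v n) + w n) := by
  rw [h n] at hn ⊢
  exact eq_of_proj_mem_Ioo hn

/-- Reflecting a recursion at the origin. -/
theorem neg (h : IsProjRec f a w v) :
    IsProjRec (fun u => -f (-u)) a (fun n => -w n) (fun n => -v n) := fun n => by
  beta_reduce
  rw [h n, ← proj_neg]
  congr 1
  simp only [neg_neg]
  ring

theorem tendsto_step (h : IsProjRec f a w v) (hf : Continuous f)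
    (ha : Tendsto a atTop (𝓝 0))
    (hw : ∃ l, Tendsto (fun n => ∑ i ∈ Finset.range n, a i * w i) atTop (𝓝 l)) :
    Tendsto (fun n => a n * (f (v n) + w n)) atTop (𝓝 0) := by
  obtain ⟨l, hl⟩ := hw
  have h1 : Tendsto (fun n => a n * w n) atTop (𝓝 0) := by
    have := ((tendsto_add_atTop_iff_nat 1).2 hl).sub hl
    simpa [Finset.sum_range_succ] using this
  obtain ⟨C, hC⟩ := (isCompact_Icc (a := (-1 : ℝ)) (b := 1)).exists_bound_of_continuousOn
    hf.continuousOn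
  have h2 : Tendsto (fun n => a n * f (v n)) atTop (𝓝 0) := by
    refine ha.zero_mul_isBoundedUnder_le ?_
    refine isBoundedUnder_of_eventually_le (a := C) ?_
    filter_upwards [eventually_ge_atTop 1] with n hn
    exact hC _ (h.mem_Icc hn)
  simpa [mul_add] using h2.add h1

/-- A recursion that visits the right of `c` infinitely often, where the mean field is positive
just to the left of `c`, eventually stays to the right of `c - δ`. -/
theorem eventually_gt (h : IsProjRec f a w v) (hf : Continuous f) (ha0 : ∀ n, 0 ≤ a n)
    (ha : Tendsto a atTop (𝓝 0))
    (hw : ∃ l, Tendsto (fun n => ∑ i ∈ Finset.range n, a i * w i) atTop (𝓝 l))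
    {c δ : ℝ} (hδ : 0 < δ) (hl : -1 ≤ c - δ) (hr : c + δ ≤ 1)
    (hpos : ∀ u ∈ Set.Icc (c - δ) c, 0 ≤ f u) (hfreq : ∃ᶠ n in atTop, c < v n) :
    ∀ᶠ n in atTop, c - δ < v n := by
  have hstep := h.tendsto_step hf ha hw
  obtain ⟨l, hlim⟩ := hw
  set S := fun n => ∑ i ∈ Finset.range n, a i * w i with hS
  have hSsucc (n : ℕ) : S (n + 1) = S n + a n * w n := Finset.sum_range_succ _ _
  obtain ⟨N, hN⟩ := eventually_atTop.1
    ((hlim.eventually (Metric.ball_mem_nhds l (show 0 < δ / 4 by positivity))).and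
      (hstep.eventually (Metric.ball_mem_nhds 0 (show 0 < δ / 4 by positivity))))
  simp only [Real.dist_eq, sub_zero] at hN
  obtain ⟨s₀, hs₀, hcs⟩ := frequently_atTop.1 hfreq N
  have hosc (m n : ℕ) (hm : N ≤ m) (hn : N ≤ n) : |S n - S m| < δ / 2 := by
    have h1 := (hN m hm).1
    have h2 := (hN n hn).1
    rw [abs_lt] at *
    constructor <;> linarith
  -- `s` marks the start of the current excursion below `c`. The drift only helps during it, so the
  -- path loses at most `δ/4` on entry and `δ/2` through noise; the remaining `δ/4` covers the next
  -- step and keeps the projection inactive.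
  have key : ∀ n, s₀ ≤ n → ∃ s, N ≤ s ∧ c - δ / 4 ≤ v n - (S n - S s) := by
    intro n hn
    induction n, hn using Nat.le_induction with
    | base => exact ⟨s₀, hs₀, by rw [sub_self, sub_zero]; linarith⟩
    | succ n hn ih =>
      have hst := abs_lt.1 (hN n (hs₀.trans hn)).2
      rcases le_or_gt c (v n) with hc | hc
      · refine ⟨n + 1, by omega, ?_⟩
        rw [sub_self, sub_zero, h n]
        exact le_max_of_le_left (le_min (by linarith) (by linarith))
      · obtain ⟨s, hs, hvs⟩ := ih
        have ho := abs_lt.1 (hosc s n hs (hs₀.trans hn))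
        have hfv : 0 ≤ a n * f (v n) := mul_nonneg (ha0 n) (hpos _ ⟨by linarith, hc.le⟩)
        refine ⟨s, hs, ?_⟩
        rw [h n, proj_eq_self ⟨by linarith, by linarith⟩, hSsucc]
        linarith
  filter_upwards [eventually_ge_atTop s₀] with n hn
  obtain ⟨s, hs, hvs⟩ := key n hn
  have ho := abs_lt.1 (hosc s n hs (hs₀.trans hn))
  linarith

/-- The recursion does not oscillate across a point at which the mean field is positive. -/
theorem not_frequently_of_pos (h : IsProjRec f a w v) (hf : Continuous f) (ha0 : ∀ n, 0 ≤ a n)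
    (ha : Tendsto a atTop (𝓝 0))
    (hw : ∃ l, Tendsto (fun n => ∑ i ∈ Finset.range n, a i * w i) atTop (𝓝 l))
    {b c e : ℝ} (hb : -1 ≤ b) (he : e ≤ 1) (hc : c ∈ Set.Ioo b e) (hfc : 0 < f c)
    (hlt : ∃ᶠ n in atTop, v n < b) (hgt : ∃ᶠ n in atTop, e < v n) : False := by
  obtain ⟨ε, hε, hball⟩ :=
    Metric.eventually_nhds_iff_ball.1 (hf.continuousAt.eventually_const_lt hfc)
  set δ := min (ε / 2) (min (c - b) (e - c)) with hδdef
  have hδ : 0 < δ := lt_min (by positivity) (lt_min (by linarith [hc.1]) (by linarith [hc.2]))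
  have h1 : δ ≤ ε / 2 := min_le_left _ _
  have h2 : δ ≤ c - b := (min_le_right _ _).trans (min_le_left _ _)
  have h3 : δ ≤ e - c := (min_le_right _ _).trans (min_le_right _ _)
  have hev := h.eventually_gt hf ha0 ha hw (c := c) hδ (by linarith) (by linarith)
    (fun u hu => (hball u (by
      rw [Real.ball_eq_Ioo]; exact ⟨by linarith [hu.1], by linarith [hu.2]⟩)).le)
    (hgt.mono fun n hn => by linarith [hc.2])
  obtain ⟨n, hn1, hn2⟩ := (hlt.and_eventually hev).exists
  linarith

theorem neg_noise (hw : ∃ l, Tendsto (fun n => ∑ i ∈ Finset.range n, a i * w i) atTop (𝓝 l)) :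
    ∃ l, Tendsto (fun n => ∑ i ∈ Finset.range n, a i * -w i) atTop (𝓝 l) := by
  obtain ⟨l, hl⟩ := hw
  exact ⟨-l, by simpa [mul_neg, Finset.sum_neg_distrib] using hl.neg⟩

/-- Oscillation across an interval would mean infinitely many crossings, in both directions, of a
point where `f` is nonzero. The negative case is the positive one reflected. -/
theorem exists_tendsto (h : IsProjRec f a w v) (hf : Continuous f) (hf0 : Dense {u | f u ≠ 0})
    (ha0 : ∀ n, 0 ≤ a n) (ha : Tendsto a atTop (𝓝 0))
    (hw : ∃ l, Tendsto (fun n => ∑ i ∈ Finset.range n, a i * w i) atTop (𝓝 l)) :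
    ∃ l, Tendsto v atTop (𝓝 l) := by
  have hIcc : ∀ᶠ n in atTop, v n ∈ Set.Icc (-1 : ℝ) 1 := by
    filter_upwards [eventually_ge_atTop 1] with n hn using h.mem_Icc hn
  refine tendsto_of_no_upcrossings dense_univ ?_
    (isBoundedUnder_of_eventually_le (hIcc.mono fun n hn => hn.2))
    (isBoundedUnder_of_eventually_ge (hIcc.mono fun n hn => hn.1))
  rintro b - e - hbe ⟨hlt, hgt⟩
  obtain ⟨c, hfc, hc⟩ := hf0.exists_mem_open isOpen_Ioo (Set.nonempty_Ioo.2 hbe)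
  obtain ⟨n, hn, hn'⟩ := (hlt.and_eventually hIcc).exists
  obtain ⟨m, hm, hm'⟩ := (hgt.and_eventually hIcc).exists
  rcases lt_or_gt_of_ne (show f c ≠ 0 from hfc) with hneg | hpos
  · refine h.neg.not_frequently_of_pos (by fun_prop) ha0 ha (neg_noise hw) (b := -e) (c := -c)
      (e := -b) (by linarith [hm'.2]) (by linarith [hn'.1])
      ⟨by linarith [hc.2], by linarith [hc.1]⟩ (by rw [neg_neg]; linarith)
      (hgt.mono fun _ h => neg_lt_neg h) (hlt.mono fun _ h => neg_lt_neg h)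
  · exact h.not_frequently_of_pos hf ha0 ha hw (by linarith [hn'.1]) (by linarith [hm'.2])
      hc hpos hlt hgt

/-- The limit of the recursion is not an interior point at which the mean field is positive. -/
theorem not_pos_of_tendsto (h : IsProjRec f a w v) (hf : Continuous f)
    (ha0 : ∀ n, 0 ≤ a n) (hsum : ¬ Summable a)
    (hw : ∃ l, Tendsto (fun n => ∑ i ∈ Finset.range n, a i * w i) atTop (𝓝 l))
    {l : ℝ} (hl : l ∈ Set.Ioo (-1 : ℝ) 1) (hv : Tendsto v atTop (𝓝 l)) : ¬ 0 < f l := by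
  intro hfl
  obtain ⟨s, hs⟩ := hw
  have hfe : ∀ᶠ n in atTop, f l / 2 < f (v n) :=
    ((hf.tendsto l).comp hv).eventually_const_lt (by linarith)
  obtain ⟨N, hN⟩ := eventually_atTop.1 (hfe.and (hv.eventually (isOpen_Ioo.mem_nhds hl)))
  -- With the noise removed, the path moves by the drift alone once the projection is inactive;
  -- boundedness of `T` then bounds the partial sums of `a`.
  set T := fun n => v n - ∑ i ∈ Finset.range n, a i * w i with hT
  have hTlim : Tendsto T atTop (𝓝 (l - s)) := hv.sub hs
  have hTsucc (n : ℕ) (hn : N ≤ n) : T n + a n * f (v n) = T (n + 1) := by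
    simp only [hT]
    rw [h.eq_of_mem_Ioo (hN (n + 1) (by omega)).2, Finset.sum_range_succ]
    ring
  obtain ⟨C, hC⟩ := hTlim.bddAbove_range
  have hbound (n : ℕ) : f l / 2 * ∑ i ∈ Finset.range n, a (i + N) ≤ T (n + N) - T N := by
    induction n with
    | zero => simp
    | succ n ih =>
      rw [Finset.sum_range_succ, mul_add, show n + 1 + N = n + N + 1 by omega,
        ← hTsucc (n + N) (by omega)]
      have := mul_le_mul_of_nonneg_left (hN (n + N) (by omega)).1.le (ha0 (n + N))
      linarith
  refine hsum ((summable_nat_add_iff N).1 ?_)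
  refine summable_of_sum_range_le (c := (C - T N) / (f l / 2)) (fun n => ha0 _) fun n => ?_
  rw [le_div_iff₀' (by positivity)]
  exact (hbound n).trans (sub_le_sub_right (hC ⟨n + N, rfl⟩) _)

/-- A recursion with summable noise converges to a zero of the mean field in the interior of the
feasible region, or to one of its end points. -/
theorem exists_tendsto_zero (h : IsProjRec f a w v) (hf : Continuous f)
    (hf0 : Dense {u | f u ≠ 0}) (ha0 : ∀ n, 0 ≤ a n) (ha : Tendsto a atTop (𝓝 0))
    (hsum : ¬ Summable a)
    (hw : ∃ l, Tendsto (fun n => ∑ i ∈ Finset.range n, a i * w i) atTop (𝓝 l)) :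
    ∃ l, Tendsto v atTop (𝓝 l) ∧ (l = -1 ∨ l = 1 ∨ (l ∈ Set.Ioo (-1 : ℝ) 1 ∧ f l = 0)) := by
  obtain ⟨l, hl⟩ := h.exists_tendsto hf hf0 ha0 ha hw
  refine ⟨l, hl, ?_⟩
  have hIcc : l ∈ Set.Icc (-1 : ℝ) 1 := isClosed_Icc.mem_of_tendsto hl <| by
    filter_upwards [eventually_ge_atTop 1] with n hn using h.mem_Icc hn
  rcases hIcc.1.eq_or_lt with h1 | h1
  · exact Or.inl h1.symm
  rcases hIcc.2.eq_or_lt with h2 | h2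
  · exact Or.inr (Or.inl h2)
  refine Or.inr (Or.inr ⟨⟨h1, h2⟩, le_antisymm ?_ ?_⟩)
  · exact not_lt.1 (h.not_pos_of_tendsto hf ha0 hsum hw ⟨h1, h2⟩ hl)
  · have := h.neg.not_pos_of_tendsto (by fun_prop) ha0 hsum (neg_noise hw) (l := -l)
      ⟨by linarith, by linarith⟩ hl.neg
    simp only [neg_neg] at this
    linarith

/-- Two recursions that differ at time `N` and receive the same noise afterwards do not converge to
the same interior point if the mean field is monotone near that point. -/
theorem eq_of_tendsto {w' v' : ℕ → ℝ} (h : IsProjRec f a w v) (h' : IsProjRec f a w' v')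
    (ha0 : ∀ n, 0 ≤ a n) {s : Set ℝ} (hs : s ⊆ Set.Ioo (-1 : ℝ) 1) (hf : MonotoneOn f s) {N : ℕ}
    (hw : ∀ n, N ≤ n → w n = w' n) (hv : ∀ n, N ≤ n → v n ∈ s) (hv' : ∀ n, N ≤ n → v' n ∈ s)
    {u : ℝ} (hu : Tendsto v atTop (𝓝 u)) (hu' : Tendsto v' atTop (𝓝 u)) : v N = v' N := by
  wlog hlt : v N ≤ v' N generalizing v v' w w'
  · exact (this h' h (fun n hn => (hw n hn).symm) hv' hv hu' hu (not_le.1 hlt).le).symm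
  -- The common noise cancels and monotonicity of `f` keeps the gap from shrinking, whereas a common
  -- limit forces it to 0.
  have key : ∀ n, N ≤ n → v' N - v N ≤ v' n - v n := by
    intro n hn
    induction n, hn using Nat.le_induction with
    | base => exact le_rfl
    | succ n hn ih =>
      rw [h.eq_of_mem_Ioo (hs (hv _ (by omega))), h'.eq_of_mem_Ioo (hs (hv' _ (by omega))), hw n hn]
      have := mul_le_mul_of_nonneg_left
        (hf (hv n hn) (hv' n hn) (by linarith)) (ha0 n)
      linarith
  have := ge_of_tendsto (hu'.sub hu) (eventually_atTop.2 ⟨N, key⟩)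
  linarith

end IsProjRec

/-! ### Almost sure avoidance of unstable zeros -/

theorem projRec_congr {f : ℝ → ℝ} {a : ℕ → ℝ} {x₀ : ℝ} {w w' : ℕ → ℝ} {N : ℕ}
    (hw : ∀ n < N, w n = w' n) : projRec f a x₀ w N = projRec f a x₀ w' N := by
  induction N with
  | zero => rfl
  | succ n ih =>
    rw [projRec, projRec, ih fun k hk => hw k (by omega), hw n (by omega)]

/-- At most one value of the noise at time `N` lets the recursion converge, inside a region where
the mean field is monotone, to a given point. -/
theorem subsingleton_noise {f : ℝ → ℝ} {a : ℕ → ℝ} (ha0 : ∀ n, 0 < a n) (x₀ : ℝ) (y : ℕ → ℝ)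
    {s : Set ℝ} (hs : s ⊆ Set.Ioo (-1 : ℝ) 1) (hf : MonotoneOn f s) (N : ℕ) (u : ℝ) :
    {t : ℝ | (∀ n, N < n → projRec f a x₀ (Function.update y N t) n ∈ s) ∧
      Tendsto (projRec f a x₀ (Function.update y N t)) atTop (𝓝 u)}.Subsingleton := by
  rintro t ⟨ht, htu⟩ t' ⟨ht', htu'⟩
  have h := isProjRec_projRec f a x₀ (Function.update y N t)
  have h' := isProjRec_projRec f a x₀ (Function.update y N t')
  -- The noise at time `N` first acts on the state at `N + 1`; the states at `N` agree.
  have h1 := h.eq_of_tendsto h' (fun n => (ha0 n).le) hs hf (N := N + 1)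
    (fun n hn => by simp [Function.update_of_ne (show n ≠ N by omega)]) ht ht' htu htu'
  rw [h.eq_of_mem_Ioo (hs (ht _ (by omega))), h'.eq_of_mem_Ioo (hs (ht' _ (by omega))),
    projRec_congr (w' := Function.update y N t') fun n hn => by
      simp [Function.update_of_ne hn.ne]] at h1
  simp only [Function.update_self] at h1
  exact add_left_cancel (mul_left_cancel₀ (ha0 N).ne' (add_left_cancel h1))

theorem measurable_projRec {f : ℝ → ℝ} (hf : Measurable f) (a : ℕ → ℝ) (n : ℕ) :
    Measurable fun p : ℝ × (ℕ → ℝ) => projRec f a p.1 p.2 n := by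
  induction n with
  | zero => exact measurable_fst
  | succ n ih =>
    refine continuous_proj.measurable.comp ?_
    fun_prop

/-- Overwriting coordinate `N` by 0 encodes all the other noises as one sequence, ready for Fubini.
-/
theorem indepFun_update {Ω : Type*} [MeasurableSpace Ω] {μ : Measure Ω} {w : ℕ → Ω → ℝ}
    (hw : ∀ n, Measurable (w n)) (hind : iIndepFun w μ) (N : ℕ) :
    IndepFun (fun ω => Function.update (fun n => w n ω) N 0) (w N) μ := by
  have h : Indep (⨆ k ∈ ({N}ᶜ : Set ℕ), MeasurableSpace.comap (w k) inferInstance)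
      (⨆ k ∈ ({N} : Set ℕ), MeasurableSpace.comap (w k) inferInstance) μ :=
    indep_iSup_of_disjoint (fun k => (hw k).comap_le) hind disjoint_compl_left
  rw [iSup_singleton] at h
  rw [IndepFun_iff_Indep]
  refine indep_of_indep_of_le_left h ?_
  rw [← measurable_iff_comap_le]
  refine @measurable_pi_lambda _ _ _ (_) _ _ fun k => ?_
  rcases eq_or_ne k N with rfl | hk
  · simp only [Function.update_self]
    exact measurable_const
  · simp only [Function.update_of_ne hk]
    rw [measurable_iff_comap_le]
    exact le_iSup₂_of_le k hk le_rfl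

/-- The recursion does not converge to an interior point near which the mean field is monotone,
as soon as the noise is independent and has no atoms. -/
theorem ae_not_tendsto {Ω : Type*} [MeasurableSpace Ω] {μ : Measure Ω} [IsProbabilityMeasure μ]
    {f : ℝ → ℝ} (hf : Measurable f) {a : ℕ → ℝ} (ha0 : ∀ n, 0 < a n)
    {x₀ : Ω → ℝ} (hx₀ : Measurable x₀) {w : ℕ → Ω → ℝ} (hw : ∀ n, Measurable (w n))
    (hatom : ∀ n, NullSingletonClass (μ.map (w n))) (hind : iIndepFun w μ)
    (hx₀w : IndepFun x₀ (fun ω n => w n ω) μ) {u ε : ℝ} (hu : u ∈ Set.Ioo (-1 : ℝ) 1)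
    (hε : 0 < ε) (hmono : MonotoneOn f (Set.Ioo (u - ε) (u + ε))) :
    ∀ᵐ ω ∂μ, ¬ Tendsto (projRec f a (x₀ ω) fun n => w n ω) atTop (𝓝 u) := by
  set s := Set.Ioo (u - ε) (u + ε) ∩ Set.Ioo (-1 : ℝ) 1 with hs
  have hso : IsOpen s := isOpen_Ioo.inter isOpen_Ioo
  have hus : u ∈ s := ⟨⟨by linarith, by linarith⟩, hu⟩
  set B : ℕ → Set (ℝ × (ℕ → ℝ)) := fun N => {p | (∀ n, N < n → projRec f a p.1 p.2 n ∈ s) ∧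
    Tendsto (projRec f a p.1 p.2) atTop (𝓝 u)} with hB
  have hmeas := measurable_projRec hf a
  have hBm (N : ℕ) : MeasurableSet (B N) := by
    refine MeasurableSet.inter ?_ ?_
    · have : {p : ℝ × (ℕ → ℝ) | ∀ n, N < n → projRec f a p.1 p.2 n ∈ s} =
          ⋂ n, ⋂ (_ : N < n), {p | projRec f a p.1 p.2 n ∈ s} := by
        ext
        simp
      change MeasurableSet {p : ℝ × (ℕ → ℝ) | ∀ n, N < n → projRec f a p.1 p.2 n ∈ s}
      rw [this]
      exact MeasurableSet.iInter fun n => MeasurableSet.iInter fun _ => hmeas n hso.measurableSet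
    · exact measurableSet_tendsto (𝓝 u) hmeas
  have hwm : Measurable fun ω n => w n ω := measurable_pi_lambda _ hw
  have hzero (N : ℕ) : ∀ᵐ ω ∂μ, (x₀ ω, fun n => w n ω) ∉ B N := by
    have hpm : Measurable fun ω => (x₀ ω, fun n => w n ω) := hx₀.prodMk hwm
    have : μ.map (fun ω => (x₀ ω, fun n => w n ω)) (B N) = 0 := by
      -- Fubini twice: fix the initial value, then all noises but the one at time `N`; the remaining
      -- slice has at most one point.
      rw [(indepFun_iff_map_prod_eq_prod_map_map hx₀.aemeasurable hwm.aemeasurable).1 hx₀w,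
        Measure.measure_prod_null (hBm N)]
      refine Eventually.of_forall fun x => ?_
      have hBx : MeasurableSet (Prod.mk x ⁻¹' B N) := measurable_prodMk_left (hBm N)
      have hup : Measurable fun ω => Function.update (fun n => w n ω) N 0 :=
        (measurable_update' (a := N)).comp (hwm.prodMk measurable_const)
      have hup2 : Measurable fun q : (ℕ → ℝ) × ℝ => Function.update q.1 N q.2 :=
        measurable_update'
      have heq : (fun ω n => w n ω) = (fun q : (ℕ → ℝ) × ℝ => Function.update q.1 N q.2) ∘
          fun ω => (Function.update (fun n => w n ω) N 0, w N ω) := by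
        funext ω
        simp
      beta_reduce
      rw [heq, ← Measure.map_map hup2 (hup.prodMk (hw N)),
        (indepFun_iff_map_prod_eq_prod_map_map hup.aemeasurable (hw N).aemeasurable).1
          (indepFun_update hw hind N), Measure.map_apply hup2 hBx,
        Pi.zero_apply,
        Measure.measure_prod_null (hup2 hBx)]
      refine Eventually.of_forall fun y => ?_
      have := hatom N
      exact (subsingleton_noise ha0 x y Set.inter_subset_right
        (hmono.mono Set.inter_subset_left) N u).measure_zero _
    rw [Measure.map_apply hpm (hBm N)] at this
    exact measure_eq_zero_iff_ae_notMem.1 this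
  filter_upwards [ae_all_iff.2 hzero] with ω hω hlim
  obtain ⟨N, hN⟩ := eventually_atTop.1 (hlim.eventually (hso.mem_nhds hus))
  exact hω N ⟨fun n hn => hN n hn.le, hlim⟩

/-! ### Convergence of the noise series -/

/-- A series of independent centred square integrable random variables with summable variances
converges almost surely. -/
theorem ae_exists_tendsto_sum {Ω : Type*} [MeasurableSpace Ω] {μ : Measure Ω}
    [IsProbabilityMeasure μ] {X : ℕ → Ω → ℝ} (hX : ∀ n, Measurable (X n))
    (hL2 : ∀ n, MemLp (X n) 2 μ) (hmean : ∀ n, μ[X n] = 0) (hind : iIndepFun X μ)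
    (hvar : Summable fun n => variance (X n) μ) :
    ∀ᵐ ω ∂μ, ∃ l, Tendsto (fun n => ∑ i ∈ Finset.range n, X i ω) atTop (𝓝 l) := by
  have hsm (n : ℕ) : StronglyMeasurable (X n) := (hX n).stronglyMeasurable
  set ℱ := Filtration.natural X hsm
  set S : ℕ → Ω → ℝ := fun n => ∑ i ∈ Finset.range (n + 1), X i with hS
  have hint (n : ℕ) : Integrable (X n) μ := (hL2 n).integrable one_le_two
  have hadX : StronglyAdapted ℱ X := Filtration.stronglyAdapted_natural hsm
  have hSad : StronglyAdapted ℱ S := fun n => by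
    refine Finset.stronglyMeasurable_sum _ fun i hi => ?_
    exact (hadX i).mono (ℱ.mono (by have := Finset.mem_range.1 hi; omega))
  have hSint (n : ℕ) : Integrable (S n) μ := integrable_finsetSum' _ fun i _ => hint i
  have hmart : Martingale S ℱ μ := by
    refine martingale_nat hSad hSint fun n => ?_
    have h1 : S (n + 1) = S n + X (n + 1) := Finset.sum_range_succ _ _
    have h2 : μ[S n | ℱ n] = S n :=
      condExp_of_stronglyMeasurable (ℱ.le n) (hSad n) (hSint n)
    have h3 := hind.condExp_natural_ae_eq_of_lt hsm (Nat.lt_succ_self n)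
    rw [h1]
    filter_upwards [condExp_add (hSint n) (hint (n + 1)) (ℱ n), h3] with ω hω hω3
    rw [hω, Pi.add_apply, h2, hω3, hmean, add_zero]
  have hSL2 (n : ℕ) : MemLp (S n) 2 μ := memLp_finsetSum' _ fun i _ => hL2 i
  have hSmean (n : ℕ) : μ[S n] = 0 := by
    simp only [hS, Finset.sum_apply]
    rw [integral_finsetSum _ fun i _ => hint i]
    exact Finset.sum_eq_zero fun i _ => hmean i
  have hSvar (n : ℕ) : variance (S n) μ ≤ ∑' n, variance (X n) μ := by
    rw [IndepFun.variance_sum (fun i _ => hL2 i) fun i _ j _ hij => hind.indepFun hij]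
    exact hvar.sum_le_tsum _ fun i _ => variance_nonneg _ _
  set C := ∑' n, variance (X n) μ
  -- The variance bound gives an L¹ bound through `|s| ≤ 1 + s²`, as martingale convergence
  -- requires.
  have hbdd (n : ℕ) : eLpNorm (S n) 1 μ ≤ (Real.toNNReal (1 + C) : ℝ≥0) := by
    rw [eLpNorm_one_eq_lintegral_enorm, ← ofReal_integral_norm_eq_lintegral_enorm (hSint n)]
    refine ENNReal.ofReal_le_ofReal ?_
    have hsq : Integrable (fun ω => S n ω ^ 2) μ := (hSL2 n).integrable_sq
    have hv := hSvar n
    rw [variance_of_integral_eq_zero (hSint n).aemeasurable (hSmean n)] at hv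
    calc ∫ ω, ‖S n ω‖ ∂μ ≤ ∫ ω, (1 + S n ω ^ 2) ∂μ := by
          refine integral_mono (hSint n).norm ((integrable_const 1).add hsq) fun ω => ?_
          have := sq_abs (S n ω)
          have h2 := sq_nonneg (|S n ω| - 1)
          rw [Real.norm_eq_abs]
          nlinarith [sq_nonneg (|S n ω|)]
      _ = 1 + ∫ ω, S n ω ^ 2 ∂μ := by
          rw [integral_add (integrable_const 1) hsq]
          simp
      _ ≤ 1 + C := by linarith
  filter_upwards [hmart.submartingale.exists_ae_tendsto_of_bdd hbdd] with ω hω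
  obtain ⟨l, hl⟩ := hω
  refine ⟨l, (tendsto_add_atTop_iff_nat 1).1 ?_⟩
  simpa [hS] using hl

/-! ### The tracker as a projected recursion -/

theorem im_observation_beamformer (M : ℕ) (d lam ρ x v : ℝ) (z : ℂ) :
    (observation M d lam ρ x (beamformer M d lam v) z).im =
      -meanField M d lam v x + z.im / √ρ := by
  unfold observation beamformer meanField
  rw [star_smul, smul_dotProduct, Complex.add_im, Complex.div_ofReal_im, Complex.star_def,
    Complex.conj_ofReal, smul_eq_mul, Complex.im_ofReal_mul]
  ring

/-- The beam tracker is a projected stochastic approximation recursion for the mean field. -/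
theorem estimate_eq_projRec (M : ℕ) (d lam ρ x : ℝ) (a : ℕ → ℝ) (x₀ : ℝ) (z : ℕ → ℂ) :
    estimate M d lam ρ x a x₀ z = projRec (fun u => meanField M d lam u x) (fun n => a (n + 1)) x₀
      (fun n => -(z (n + 1)).im / √ρ) := by
  funext n
  induction n with
  | zero => rfl
  | succ n ih =>
    rw [estimate, projRec, ih, im_observation_beamformer]
    congr 1
    ring

theorem map_im_complexGaussian (s : ℝ≥0) :
    (complexGaussian 0 s).map Complex.im = gaussianReal 0 (s / 2) := by
  rw [complexGaussian, Measure.map_map Complex.measurable_im (by fun_prop)]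
  have : (Complex.im ∘ fun p : ℝ × ℝ => (0 : ℂ) + ((p.1 : ℂ) + (p.2 : ℂ) * Complex.I)) =
      Prod.snd := by
    funext p
    simp
  rw [this]
  exact Measure.map_snd_prod.trans (by simp)

/-! ### Step sizes -/

section stepSize

variable {α N₀ : ℝ}

theorem stepSize_pos (hα : 0 < α) (hN₀ : 0 ≤ N₀) (n : ℕ) : 0 < stepSize α N₀ (n + 1) := by
  unfold stepSize
  positivity

theorem tendsto_stepSize (α N₀ : ℝ) : Tendsto (fun n => stepSize α N₀ (n + 1)) atTop (𝓝 0) := by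
  have h : Tendsto (fun n : ℕ => (n : ℝ) + N₀) atTop atTop :=
    tendsto_atTop_add_const_right _ _ tendsto_natCast_atTop_atTop
  exact (tendsto_add_atTop_iff_nat 1).2 (h.const_div_atTop α)

theorem not_summable_stepSize (hα : 0 < α) (hN₀ : 0 ≤ N₀) :
    ¬ Summable fun n => stepSize α N₀ (n + 1) := by
  intro h
  obtain ⟨K, hK⟩ := exists_nat_ge N₀
  refine Real.not_summable_one_div_natCast ((summable_nat_add_iff (1 + K)).1 ?_)
  refine Summable.of_nonneg_of_le (fun n => by positivity) (fun n => ?_) (h.mul_left (1 / α))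
  rw [stepSize, one_div_mul_eq_div, div_div_cancel_left' hα.ne', ← one_div]
  have : (0 : ℝ) ≤ n := by positivity
  apply one_div_le_one_div_of_le <;> push_cast <;> linarith

theorem summable_stepSize_sq (hN₀ : 0 ≤ N₀) : Summable fun n => stepSize α N₀ (n + 1) ^ 2 := by
  have h : Summable fun n : ℕ => 1 / ((n : ℝ) + 1) ^ 2 := by
    simpa using (summable_nat_add_iff 1).2 (Real.summable_one_div_nat_pow.2 one_lt_two)
  refine Summable.of_nonneg_of_le (fun n => sq_nonneg _) (fun n => ?_) (h.mul_left (α ^ 2))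
  rw [stepSize, div_pow, mul_one_div]
  push_cast
  refine div_le_div_of_nonneg_left (sq_nonneg _) (by positivity) ?_
  exact pow_le_pow_left₀ (by positivity) (by linarith) 2

end stepSize

end BeamTracking

/-! ### Assembly -/

open BeamTracking in
theorem theorem1
    {Ω : Type*} [MeasurableSpace Ω] (μ : Measure Ω) [IsProbabilityMeasure μ]
    (M : ℕ) (hM : 2 ≤ M)
    (d lam ρ : ℝ) (hd : 0 < d) (hlam : 0 < lam) (hρ : 0 < ρ)
    (x : ℝ) (hx : x ∈ Set.Icc (-1 : ℝ) 1)
    (x₀ : Ω → ℝ) (hx₀ : Measurable x₀)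
    (z : ℕ → Ω → ℂ) (hz : ∀ n, 1 ≤ n → Measurable (z n))
    (hz_law : ∀ n, 1 ≤ n → μ.map (z n) = BeamTracking.complexGaussian 0 1)
    (hz_indep : iIndepFun (fun n : ℕ => z (n + 1)) μ)
    (hx₀z : IndepFun x₀ (fun ω (n : ℕ) => z (n + 1) ω) μ)
    (α N₀ : ℝ) (hα : 0 < α) (hN₀ : 0 ≤ N₀) :
    BeamTracking.stablePoints M d lam x =
        {v | v ∈ Set.Ioc (-1 : ℝ) 1 ∧ ∃ k : ℤ, v = x + k * lam / (((M : ℝ) - 1) * d)} ∧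
      ∀ᵐ ω ∂μ, ∃ v ∈ BeamTracking.stablePoints M d lam x ∪ {-1} ∪ {1},
        Tendsto (fun n : ℕ => BeamTracking.estimate M d lam ρ x
          (BeamTracking.stepSize α N₀) (x₀ ω) (fun n => z n ω) n) atTop (𝓝 v) := by
  refine ⟨stablePoints_eq hM hd hlam x, ?_⟩
  set f : ℝ → ℝ := fun u => meanField M d lam u x with hf
  set a : ℕ → ℝ := fun n => stepSize α N₀ (n + 1) with ha
  set φ : ℂ → ℝ := fun c => -c.im / √ρ with hφ
  set w : ℕ → Ω → ℝ := fun n ω => φ (z (n + 1) ω) with hw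
  have hφm : Measurable φ := by fun_prop
  have hwm (n : ℕ) : Measurable (w n) := hφm.comp (hz (n + 1) (by omega))
  have hfc : Continuous f := continuous_meanField M d lam x
  have hind : iIndepFun w μ := hz_indep.comp (fun _ => φ) fun _ => hφm
  have hx₀w : IndepFun x₀ (fun ω n => w n ω) μ :=
    hx₀z.comp (φ := id) (ψ := fun (c : ℕ → ℂ) (n : ℕ) => φ (c n)) measurable_id (by fun_prop)
  obtain ⟨σ, hσ, hlaw⟩ : ∃ σ : ℝ≥0, σ ≠ 0 ∧ ∀ n, μ.map (w n) = gaussianReal 0 σ := by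
    -- The imaginary part carries half of the unit variance and is scaled by `-1/√ρ`.
    refine ⟨NNReal.mk ((-1 / √ρ) ^ 2) (sq_nonneg _) * (1 / 2), ?_, fun n => ?_⟩
    · have : 0 < (-1 / √ρ) ^ 2 := by
        have := Real.sqrt_pos.2 hρ
        rw [div_pow]
        positivity
      exact mul_ne_zero (fun h => this.ne' (congrArg NNReal.toReal h)) (by norm_num)
    · have h1 : w n = (fun t => -1 / √ρ * t) ∘ Complex.im ∘ z (n + 1) := by
        funext ω
        simp only [hw, hφ, Function.comp_apply]
        ring
      rw [h1, ← Measure.map_map (by fun_prop) (by have := hz (n + 1) (by omega); fun_prop),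
        ← Measure.map_map Complex.measurable_im (hz (n + 1) (by omega)),
        hz_law (n + 1) (by omega), map_im_complexGaussian, gaussianReal_map_const_mul, mul_zero]
  have hwlaw (n : ℕ) : HasLaw (w n) (gaussianReal 0 σ) μ := ⟨(hwm n).aemeasurable, hlaw n⟩
  have hnoise : ∀ᵐ ω ∂μ, ∃ l,
      Tendsto (fun n => ∑ i ∈ Finset.range n, a i * w i ω) atTop (𝓝 l) := by
    have hwL2 (n : ℕ) : MemLp (w n) 2 μ := by
      have := memLp_id_gaussianReal' (μ := 0) (v := σ) 2 (by norm_num)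
      rw [← hlaw n] at this
      exact this.comp_of_map (hwm n).aemeasurable
    refine ae_exists_tendsto_sum (X := fun n ω => a n * w n ω) (fun n => (hwm n).const_mul _)
      (fun n => (hwL2 n).const_mul _) (fun n => ?_)
      (hind.comp (fun n t => a n * t) fun n => by fun_prop) ?_
    · rw [integral_const_mul, (hwlaw n).integral_eq, integral_id_gaussianReal, mul_zero]
    · simp only [variance_const_mul, (hwlaw _).variance_eq, variance_id_gaussianReal]
      exact (summable_stepSize_sq hN₀).mul_right _
  have hunstable : ∀ᵐ ω ∂μ, ∀ u ∈ {u | f u = 0}, u ∈ Set.Ioo (-1 : ℝ) 1 → 0 < deriv f u →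
      ¬ Tendsto (projRec f a (x₀ ω) fun n => w n ω) atTop (𝓝 u) := by
    -- The exceptional null set depends on `u`, so countability is needed to exclude all unstable
    -- zeros at once.
    rw [ae_ball_iff (countable_meanField_zeros hM hd hlam x)]
    intro u _
    by_cases h : u ∈ Set.Ioo (-1 : ℝ) 1 ∧ 0 < deriv f u
    · obtain ⟨ε, hε, hmono⟩ := exists_monotoneOn_of_deriv_pos (f := f)
        (fun v => (hasDerivAt_meanField M d lam v x).differentiableAt)
        (continuous_deriv_meanField M d lam x) h.2
      filter_upwards [ae_not_tendsto hfc.measurable (stepSize_pos hα hN₀) hx₀ hwm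
        (fun n => by rw [hlaw n]; exact nullSingletonClass_gaussianReal hσ) hind hx₀w h.1 hε
        hmono] with ω hω _ _ using hω
    · exact Eventually.of_forall fun ω h1 h2 => absurd ⟨h1, h2⟩ h
  filter_upwards [hnoise, hunstable] with ω hω hω'
  obtain ⟨l, hl, hcase⟩ := (isProjRec_projRec f a (x₀ ω) fun n => w n ω).exists_tendsto_zero hfc
    ((countable_meanField_zeros hM hd hlam x).dense_compl ℝ)
    (fun n => (stepSize_pos hα hN₀ n).le) (tendsto_stepSize α N₀)
    (not_summable_stepSize hα hN₀) hω
  refine ⟨l, ?_, ?_⟩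
  · rcases hcase with rfl | rfl | ⟨hl1, hl0⟩
    · simp
    · simp
    · refine Or.inl (Or.inl ⟨⟨hl1.1, hl1.2.le⟩, hl0, ?_⟩)
      by_contra h
      exact hω' l hl0 hl1 (deriv_meanField_pos hM hd hlam hl0 h) hl
  · rw [estimate_eq_projRec]
    exact hl
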